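/- Let $M, N \ge 1$ and consider the circle of length one divided into $M$ slots $x/M$, $x \in \mathbb{Z}/M$, with the distance $d(u,v)=\min(|v-u|,\,1-|v-u|)$. A configuration $s$ is an unordered $N$-tuple (multiset) of slots, the positions of $N$ drivers. Let $P$ and $Q$ be arbitrary (not necessarily uniform) probability distributions on the slots with $P(x)>0$ and $Q(x)>0$ for every slot $x$. At every stage $t$, with drivers at $S^t$, a user arrives at a slot $u_t\sim Q$; a policy $\rho$ (a function of $(s,u)$ with values among the drivers of $s$) assigns the driver $a=\rho(S^t,u_t)$ to the user at cost $c_t=d(u_t,a)$; this driver disappears and is replaced by a new driver at $y_t\sim P$, where all arrivals are independent. For an initial configuration $s_0$, a policy is called optimal if it minimises the long-run average cost $\lim_{T\to\infty}\frac1T\sum_{t<T}\mathbb{E}[c_t \mid S^0=s_0]$ among all such policies. Let $R(u,s)$ and $L(u,s)$ be the first driver to the right and to the left of $u$, respectively, with $R(u,s)=L(u,s)=u$ if there is a driver at $u$. Theorem. Let $\rho$ be an optimal policy for some initial configuration $s_0$. Then for every configuration $s$ and every user position $u$, $\rho(s,u)\in\{R(u,s),L(u,s)\}$. Moreover, at least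 half of the actions of $\rho$ are greedy: for every configuration $s$, for at least $M/2$ of the $M$ user positions $u$ the assigned driver $\rho(s,u)$ is at minimal distance from $u$ among the drivers of $s$; consequently, this holds for at least half of all pairs $(s,u)$. -/

import Mathlib

open Filter

namespace CircleMatching

/-- The `M` slots of the discretised circle of length one; slot `x` sits at the point `x.val / M`,
and `x + 1` is the next slot to the right. -/
abbrev Slot (M : ℕ) : Type := ZMod M

/-- The distance `d(u, v) = min (|v - u|, 1 - |v - u|)` along the circle of length one. -/
noncomputable def circleDist {M : ℕ} (u v : Slot M) : ℝ :=
  min (|(v.val : ℝ) / M - (u.val : ℝ) / M|) (1 - |(v.val : ℝ) / M - (u.val : ℝ) / M|)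

/-- A configuration of `N` drivers, as an unordered `N`-tuple of slots (several drivers may share
a slot). Unordered tuples are the same as tuples sorted in increasing order. -/
abbrev Config (M N : ℕ) : Type := Sym (Slot M) N

/-- A (stationary, deterministic) policy: given the drivers `s` and the user `u` it selects a driver
of `s`. Drivers in the same slot are interchangeable, so a driver is given by its slot. -/
abbrev Policy (M N : ℕ) : Type := (s : Config M N) → Slot M → {a : Slot M // a ∈ s}

/-- The configuration after the driver at `a` has been assigned and a new one has appeared at `y`. -/
def replace {M N : ℕ} (s : Config M N) (a : {a : Slot M // a ∈ s}) (y : Slot M) : Config M N :=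
  ⟨y ::ₘ (s : Multiset (Slot M)).erase a.1, by
    have ha : a.1 ∈ (s : Multiset (Slot M)) := a.2
    have hs : Multiset.card (s : Multiset (Slot M)) = N := s.2
    rw [Multiset.card_cons, Multiset.card_erase_add_one ha, hs]⟩

/-- The transition matrix of the drivers' configuration under `ρ`: in each stage a user appears
according to `Q` and, independently, a new driver according to `P`. -/
noncomputable def transition {M N : ℕ} [NeZero M] (P Q : Slot M → ℝ) (ρ : Policy M N) :
    Matrix (Config M N) (Config M N) ℝ :=
  fun s s' => ∑ u : Slot M, ∑ y : Slot M, if replace s (ρ s u) y = s' then Q u * P y else 0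

/-- The expected cost of one stage that starts with the drivers at `s`. -/
noncomputable def stageCost {M N : ℕ} [NeZero M] (Q : Slot M → ℝ) (ρ : Policy M N)
    (s : Config M N) : ℝ :=
  ∑ u : Slot M, Q u * circleDist u (ρ s u).1

/-- The expected cost of the stage `t = 0, 1, 2, …` when the drivers start at `s₀`. -/
noncomputable def expectedCost {M N : ℕ} [NeZero M] (P Q : Slot M → ℝ) (ρ : Policy M N)
    (s₀ : Config M N) (t : ℕ) : ℝ :=
  ∑ s : Config M N, (transition P Q ρ ^ t) s₀ s * stageCost Q ρ s

/-- The long-run average expected cost per stage. (The averages lie in `[0, 1/2]`; for a finite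
chain they converge, so that the `limsup` is a limit.) -/
noncomputable def averageCost {M N : ℕ} [NeZero M] (P Q : Slot M → ℝ) (ρ : Policy M N)
    (s₀ : Config M N) : ℝ :=
  limsup (fun T : ℕ => (∑ t ∈ Finset.range T, expectedCost P Q ρ s₀ t) / T) atTop

/-- `ρ` minimises the long-run average cost among all policies, for the initial drivers `s₀`. -/
def IsOptimal {M N : ℕ} [NeZero M] (P Q : Slot M → ℝ) (s₀ : Config M N) (ρ : Policy M N) : Prop :=
  ∀ ρ' : Policy M N, averageCost P Q ρ s₀ ≤ averageCost P Q ρ' s₀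

/-- `R(u, s)`: the first driver's slot met when walking from `u` to the right
(`u` itself if there is a driver at `u`). -/
noncomputable def rightNeighbour {M N : ℕ} (u : Slot M) (s : Config M N) : Slot M :=
  u + ((sInf {k : ℕ | u + (k : Slot M) ∈ s} : ℕ) : Slot M)

/-- `L(u, s)`: the first driver's slot met when walking from `u` to the left
(`u` itself if there is a driver at `u`). -/
noncomputable def leftNeighbour {M N : ℕ} (u : Slot M) (s : Config M N) : Slot M :=
  u - ((sInf {k : ℕ | u - (k : Slot M) ∈ s} : ℕ) : Slot M)

/-- With drivers `s` and user `u`, the action of `ρ` is greedy: no driver is strictly closer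
to the user than the assigned one. -/
def IsGreedyAt {M N : ℕ} (ρ : Policy M N) (s : Config M N) (u : Slot M) : Prop :=
  ∀ b ∈ s, circleDist u (ρ s u).1 ≤ circleDist u b

end CircleMatching

/-!
# Optimal policies assign neighbouring drivers, and half of the time the nearest one

An optimal policy is studied through the optimality equation `g + h s = bellman P Q h s` of the
average cost problem, where `g` is the least average cost and `h s` the relative value of the
drivers `s`. A solution exists (`exists_bellman_eq`): it is a limit of normalised values of
discounted problems, which are uniformly bounded because moving one driver changes them by at most
the distance of the move.

The heart of the matter is that moving one driver changes a solution `h` by *strictly* less than the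
distance of the move (`lt_of_bellman_eq`), which is a maximum principle. After a move from `u` to
`b` one can imitate the actions before the move, the driver at `b` standing in for the one at `u`.
If this loses the full distance, it does so for every user, in particular for one at `b`, who could
have been served at no cost; hence the move can be extended beyond `b`, or another driver sits
at `b`, and neither can go on forever.

Consequently an action that is optimal for `h` never passes over a driver on the way from the user
to the assigned driver (`eq_of_actionValue_le`), so that it assigns one of the two neighbours of the
user, and the driver in the user's slot if there is one.

An optimal policy for one initial configuration need not, a priori, act optimally for `h` at
configurations that it visits rarely. A limit of its mean occupation measures is a stationary
distribution, and optimality forces its actions to be optimal for `h` on the support of that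
distribution (`exists_stationary`). There every user in a driver's slot is served by that driver, so
that the next configuration can be obtained from the present one by an arbitrary move of an
arbitrary driver. So the support contains all configurations (`actionValue_eq_of_isOptimal`).

For the last part, reflect the users in each gap between consecutive drivers. If the farther
neighbour is assigned to a user, this neighbour is the less valuable one to keep, and it is also the
nearer one for the reflected user, who is therefore served greedily (`isGreedyAt_reflection`). The
reflection is injective, so at most half of the users are not served greedily.
-/

namespace CircleMatching

/-! ### The distance along the circle -/

section Distance

variable {M : ℕ}

lemma circleDist_comm (u v : Slot M) : circleDist u v = circleDist v u := by
  unfold circleDist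
  rw [abs_sub_comm]

variable [NeZero M]

/-- The distance depends only on the difference of the two slots, through its absolutely smallest
integer representative. -/
lemma circleDist_eq (u v : Slot M) :
    circleDist u v = ((v - u).valMinAbs.natAbs : ℝ) / M := by
  wlog h : u.val ≤ v.val generalizing u v
  · rw [circleDist_comm, this v u (le_of_not_ge h), ← neg_sub v u, ZMod.natAbs_valMinAbs_neg]
  have hM : (0 : ℝ) < M := Nat.cast_pos.2 (NeZero.pos M)
  have hv : v.val < M := ZMod.val_lt v
  have hR : (u.val : ℝ) ≤ v.val := Nat.cast_le.2 h
  rw [ZMod.valMinAbs_natAbs_eq_min, ZMod.val_sub h]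
  unfold circleDist
  rw [← sub_div, abs_of_nonneg (by have := sub_nonneg.2 hR; positivity), Nat.cast_min,
    Nat.cast_sub h, Nat.cast_sub (show v.val - u.val ≤ M by omega), Nat.cast_sub h,
    ← min_div_div_right hM.le, sub_div (M : ℝ), div_self hM.ne']

@[simp] lemma circleDist_self (u : Slot M) : circleDist u u = 0 := by
  simp [circleDist_eq]

lemma circleDist_nonneg (u v : Slot M) : 0 ≤ circleDist u v := by
  rw [circleDist_eq]; positivity

lemma circleDist_pos {u v : Slot M} (h : u ≠ v) : 0 < circleDist u v := by
  have hM : (0 : ℝ) < M := Nat.cast_pos.2 (NeZero.pos M)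
  rw [circleDist_eq]
  refine div_pos (Nat.cast_pos.2 (Int.natAbs_pos.2 fun h0 => h ?_)) hM
  exact (sub_eq_zero.1 ((ZMod.valMinAbs_eq_zero _).1 h0)).symm

lemma circleDist_triangle (u v w : Slot M) :
    circleDist u w ≤ circleDist u v + circleDist v w := by
  simp only [circleDist_eq, ← add_div]
  gcongr
  have := ZMod.natAbs_valMinAbs_add_le (v - u) (w - v)
  rw [show v - u + (w - v) = w - u by ring] at this
  exact_mod_cast this.trans (Int.natAbs_add_le _ _)

lemma circleDist_congr {u v u' v' : Slot M} (h : v - u = v' - u') :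
    circleDist u v = circleDist u' v' := by
  rw [circleDist_eq, circleDist_eq, h]

lemma circleDist_add_natCast (u : Slot M) {k : ℕ} (hk : 2 * k ≤ M) :
    circleDist u (u + k) = (k : ℝ) / M := by
  rw [circleDist_eq, add_sub_cancel_left, ZMod.valMinAbs_natCast_of_le_half (by omega),
    Int.natAbs_natCast]

end Distance

/-! ### The neighbouring drivers -/

section Neighbours

variable {M N : ℕ} [NeZero M]

lemma exists_add_natCast_mem {s : Config M N} {a : Slot M} (ha : a ∈ s) (u : Slot M) :
    u + (((a - u).val : ℕ) : Slot M) ∈ s := by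
  simpa using ha

lemma exists_sub_natCast_mem {s : Config M N} {a : Slot M} (ha : a ∈ s) (u : Slot M) :
    u - (((u - a).val : ℕ) : Slot M) ∈ s := by
  simpa using ha

lemma rightNeighbour_mem {s : Config M N} {a : Slot M} (ha : a ∈ s) (u : Slot M) :
    rightNeighbour u s ∈ s :=
  Nat.sInf_mem (s := {k : ℕ | u + (k : Slot M) ∈ s}) ⟨_, exists_add_natCast_mem ha u⟩

lemma leftNeighbour_mem {s : Config M N} {a : Slot M} (ha : a ∈ s) (u : Slot M) :
    leftNeighbour u s ∈ s :=
  Nat.sInf_mem (s := {k : ℕ | u - (k : Slot M) ∈ s}) ⟨_, exists_sub_natCast_mem ha u⟩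

/-- Whichever way round the circle a driver `a` is nearest to `u`, the first driver met on that way
lies on a shortest path from `u` to `a`. -/
lemma circleDist_eq_add_neighbour {s : Config M N} {a : Slot M} (ha : a ∈ s) (u : Slot M) :
    circleDist u a = circleDist u (rightNeighbour u s) + circleDist (rightNeighbour u s) a ∨
      circleDist u a = circleDist u (leftNeighbour u s) + circleDist (leftNeighbour u s) a := by
  by_cases h : 2 * (a - u).val ≤ M
  · left
    have hj : sInf {k : ℕ | u + (k : Slot M) ∈ s} ≤ (a - u).val :=
      Nat.sInf_le (exists_add_natCast_mem ha u)
    have hR : rightNeighbour u s = u + ((sInf {k : ℕ | u + (k : Slot M) ∈ s} : ℕ) : Slot M) := rfl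
    generalize sInf {k : ℕ | u + (k : Slot M) ∈ s} = j at hj hR
    obtain ⟨i, hi⟩ := Nat.exists_eq_add_of_le hj
    have hai : a = u + j + i := by
      have := ZMod.natCast_zmod_val (a - u)
      rw [hi, Nat.cast_add] at this
      linear_combination -this
    rw [hR, circleDist_add_natCast u (by omega), hai, circleDist_add_natCast _ (by omega),
      add_assoc, ← Nat.cast_add, circleDist_add_natCast u (by omega), Nat.cast_add, add_div]
  · right
    have hlt := ZMod.val_lt (a - u)
    have hne : NeZero (a - u) := ⟨fun h0 => h (by rw [h0]; simp)⟩
    have hval : (u - a).val = M - (a - u).val := by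
      rw [← neg_sub a u, ZMod.val_neg_of_ne_zero]
    have hj : sInf {k : ℕ | u - (k : Slot M) ∈ s} ≤ (u - a).val :=
      Nat.sInf_le (exists_sub_natCast_mem ha u)
    have hL : leftNeighbour u s = u - ((sInf {k : ℕ | u - (k : Slot M) ∈ s} : ℕ) : Slot M) := rfl
    generalize sInf {k : ℕ | u - (k : Slot M) ∈ s} = j at hj hL
    obtain ⟨i, hi⟩ := Nat.exists_eq_add_of_le hj
    have hua : u = a + i + j := by
      have := ZMod.natCast_zmod_val (u - a)
      rw [hi, Nat.cast_add] at this
      linear_combination -this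
    rw [hL, circleDist_comm u a, circleDist_comm u, circleDist_comm _ a, hua, add_sub_cancel_right,
      circleDist_add_natCast _ (by omega), circleDist_add_natCast _ (by omega),
      add_assoc, ← Nat.cast_add, circleDist_add_natCast a (by omega), Nat.cast_add, add_div,
      add_comm]

/-- Moving the origin of a line from `0` to the mirror image `j - i` of `0` in the gap `[-i, j]`
between two consecutive points of `p` exchanges the distances to the two end points. -/
lemma sInf_reflect (p : ℤ → Prop) {i j : ℕ} (hj : p j)
    (hi' : ∀ k < i, ¬ p (-(k : ℤ))) (hj' : ∀ k < j, ¬ p k) :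
    sInf {k : ℕ | p (j - i + k)} = i := by
  refine le_antisymm (Nat.sInf_le (by simpa using hj)) ?_
  refine le_csInf ⟨i, by simpa using hj⟩ fun k (hk : p _) => ?_
  by_contra! hlt
  rcases le_total i (j + k) with h | h
  · rcases Nat.eq_zero_or_pos j with rfl | hj0
    · exact hi' 0 (by omega) (by simpa using hj)
    · refine hj' (j + k - i) (by omega) ?_
      rwa [show ((j + k - i : ℕ) : ℤ) = j - i + k by omega]
  · rcases Nat.eq_zero_or_pos (j + k) with h0 | h0
    · obtain ⟨rfl, rfl⟩ : j = 0 ∧ k = 0 := by omega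
      exact hi' 0 (by omega) (by simpa using hj)
    · refine hi' (i - (j + k)) (by omega) ?_
      rwa [show -((i - (j + k) : ℕ) : ℤ) = j - i + k by omega]

/-- The mirror image of `u` in the gap between its neighbouring drivers. -/
noncomputable def reflection (s : Config M N) (u : Slot M) : Slot M :=
  leftNeighbour u s + rightNeighbour u s - u

lemma neighbours_reflection {s : Config M N} {a : Slot M} (ha : a ∈ s) (u : Slot M) :
    rightNeighbour (reflection s u) s = rightNeighbour u s ∧
      leftNeighbour (reflection s u) s = leftNeighbour u s := by
  have hR : rightNeighbour u s = u + ((sInf {k : ℕ | u + (k : Slot M) ∈ s} : ℕ) : Slot M) := rfl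
  have hL : leftNeighbour u s = u - ((sInf {k : ℕ | u - (k : Slot M) ∈ s} : ℕ) : Slot M) := rfl
  have hRm := rightNeighbour_mem ha u
  have hLm := leftNeighbour_mem ha u
  have hj' : ∀ k < sInf {k : ℕ | u + (k : Slot M) ∈ s}, ¬ (u + (k : Slot M) ∈ s) :=
    fun k hk => Nat.notMem_of_lt_sInf hk
  have hi' : ∀ k < sInf {k : ℕ | u - (k : Slot M) ∈ s}, ¬ (u - (k : Slot M) ∈ s) :=
    fun k hk => Nat.notMem_of_lt_sInf hk
  have hu : reflection s u = leftNeighbour u s + rightNeighbour u s - u := rfl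
  generalize rightNeighbour u s = R at *
  generalize leftNeighbour u s = L at *
  generalize sInf {k : ℕ | u + (k : Slot M) ∈ s} = j at *
  generalize sInf {k : ℕ | u - (k : Slot M) ∈ s} = i at *
  rw [hR] at hRm
  rw [hL] at hLm
  have key := sInf_reflect (fun z : ℤ => u + (z : Slot M) ∈ s) (i := i) (j := j)
    (by simpa using hRm)
    (by simpa [← sub_eq_add_neg] using hi') (by simpa using hj')
  have key' := sInf_reflect (fun z : ℤ => u - (z : Slot M) ∈ s) (i := j) (j := i)
    (by simpa using hLm)
    (by simpa using hj') (by simpa using hi')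
  have hu' : reflection s u = u + j - i := by rw [hu, hR, hL]; ring
  constructor
  · have : {k : ℕ | reflection s u + (k : Slot M) ∈ s} =
        {k : ℕ | u + (((j : ℤ) - i + k : ℤ) : Slot M) ∈ s} := by
      ext k
      have : u + j - i + (k : Slot M) = u + (j - i + k) := by ring
      simp [hu', this]
    rw [rightNeighbour, this, key, hu', hR]
    ring
  · have : {k : ℕ | reflection s u - (k : Slot M) ∈ s} =
        {k : ℕ | u - (((i : ℤ) - j + k : ℤ) : Slot M) ∈ s} := by
      ext k
      have : u + j - i - (k : Slot M) = u - (i - j + k) := by ring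
      simp [hu', this]
    rw [leftNeighbour, this, key', hu', hL]
    ring

lemma reflection_injective {s : Config M N} {a : Slot M} (ha : a ∈ s) :
    Function.Injective (reflection s) := by
  intro u v h
  have hu := neighbours_reflection ha u
  have hv := neighbours_reflection ha v
  have h' : leftNeighbour u s + rightNeighbour u s - u =
      leftNeighbour v s + rightNeighbour v s - v := h
  rw [← hu.1, ← hu.2, ← hv.1, ← hv.2, h] at h'
  exact sub_right_injective h'

end Neighbours

/-! ### Replacing a driver -/

section Replace

variable {M n : ℕ}

lemma replace_eq_of_cons {s : Config M (n + 1)} {a : {a : Slot M // a ∈ s}} {t : Config M n}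
    (h : s = a.1 ::ₛ t) (y : Slot M) : replace s a y = y ::ₛ t := by
  obtain ⟨a, ha⟩ := a
  change s = a ::ₛ t at h
  subst h
  apply Sym.ext
  show y ::ₘ ((a ::ₛ t : Config M (n + 1)) : Multiset (Slot M)).erase a = y ::ₘ (t : Multiset _)
  rw [Sym.coe_cons, Multiset.erase_cons_head]

lemma replace_cons_of_mem {t : Config M n} {c b : Slot M} (hc : c ∈ t)
    (hc' : c ∈ b ::ₛ t) (y : Slot M) :
    replace (b ::ₛ t) ⟨c, hc'⟩ y = b ::ₛ replace t ⟨c, hc⟩ y := by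
  apply Sym.ext
  show y ::ₘ ((b ::ₛ t : Config M (n + 1)) : Multiset (Slot M)).erase c =
    b ::ₘ (y ::ₘ (t : Multiset (Slot M)).erase c)
  rw [Sym.coe_cons, Multiset.erase_cons_tail_of_mem (by exact hc), Multiset.cons_swap]

lemma cons_replace {t : Config M n} {c : Slot M} (hc : c ∈ t) (y : Slot M) :
    c ::ₛ replace t ⟨c, hc⟩ y = y ::ₛ t := by
  apply Sym.ext
  show c ::ₘ (y ::ₘ (t : Multiset (Slot M)).erase c) = y ::ₘ (t : Multiset (Slot M))
  rw [Multiset.cons_swap, Multiset.cons_erase (show c ∈ (t : Multiset (Slot M)) from hc)]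

/-- Every configuration is reached from every other one by moving one driver at a time. -/
lemma forall_of_forall_move {p : Config M (n + 1) → Prop}
    (hp : ∀ (t : Config M n) (a y : Slot M), p (a ::ₛ t) → p (y ::ₛ t))
    {s₀ : Config M (n + 1)} (h₀ : p s₀) (s : Config M (n + 1)) : p s := by
  -- Move the drivers in the part `t` one after the other to the positions in `t'`; the drivers in
  -- `w` already sit where they belong.
  have key : ∀ (t' t w : Multiset (Slot M)) (r r' : Config M (n + 1)),
      (r : Multiset (Slot M)) = t + w → (r' : Multiset (Slot M)) = t' + w → p r → p r' := by
    intro t'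
    induction t' using Multiset.induction with
    | empty =>
      intro t w r r' hr hr' h
      have hc : Multiset.card t + Multiset.card w = 0 + Multiset.card w := by
        rw [← Multiset.card_add, ← hr, Sym.card_coe, ← Multiset.card_zero, ← Multiset.card_add,
          ← hr', Sym.card_coe]
      obtain rfl : t = 0 := Multiset.card_eq_zero.1 (by omega)
      rwa [← Sym.ext (hr.trans hr'.symm)]
    | cons b t' ih =>
      intro t w r r' hr hr' h
      have hc : Multiset.card t + Multiset.card w = Multiset.card (b ::ₘ t') + Multiset.card w := by
        rw [← Multiset.card_add, ← hr, Sym.card_coe, ← Multiset.card_add, ← hr', Sym.card_coe]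
      obtain ⟨a, ha⟩ := Multiset.card_pos_iff_exists_mem.1
        (show 0 < Multiset.card t by rw [Multiset.card_cons] at hc; omega)
      obtain ⟨t, rfl⟩ := Multiset.exists_cons_of_mem ha
      have hn : Multiset.card (t + w) = n := by
        have := r.card_coe
        rw [hr, Multiset.cons_add, Multiset.card_cons] at this
        omega
      have hra : r = a ::ₛ (⟨t + w, hn⟩ : Config M n) := 
        Sym.ext (by rw [hr, Multiset.cons_add]; rfl)
      refine ih t (b ::ₘ w) (b ::ₛ ⟨t + w, hn⟩) r' (by rw [Multiset.add_cons]; rfl) (by simp [hr'])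
        (hp _ a b ?_)
      rwa [← hra]
  exact key s s₀ 0 s₀ s (by simp) (by simp) h₀

end Replace

/-! ### The Bellman operator -/

section Bellman

variable {M N n : ℕ} [NeZero M]

/-- The expected value of the next configuration when the driver at `a` is assigned. -/
noncomputable def nextValue (P : Slot M → ℝ) (h : Config M N → ℝ) (s : Config M N)
    (a : {a : Slot M // a ∈ s}) : ℝ :=
  ∑ y, P y * h (replace s a y)

/-- The expected total of the present cost and the value `h` of the next configuration when the
driver at `a` is assigned to the user `u`. -/
noncomputable def actionValue (P : Slot M → ℝ) (h : Config M N → ℝ) (s : Config M N) (u : Slot M)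
    (a : {a : Slot M // a ∈ s}) : ℝ :=
  circleDist u a.1 + nextValue P h s a

/-- The least `actionValue` over all drivers in `s`. -/
noncomputable def userValue (P : Slot M → ℝ) (h : Config M N → ℝ) (s : Config M N)
    (u : Slot M) : ℝ :=
  ⨅ a, actionValue P h s u a

/-- The Bellman operator of the matching problem. -/
noncomputable def bellman (P Q : Slot M → ℝ) (h : Config M N → ℝ) (s : Config M N) : ℝ :=
  ∑ u, Q u * userValue P h s u

instance nonempty_driver (s : Config M (n + 1)) : Nonempty {a : Slot M // a ∈ s} :=
  let ⟨a, ha⟩ := s.exists_mem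
  ⟨⟨a, ha⟩⟩

variable {P Q : Slot M → ℝ}

lemma userValue_le (h : Config M N → ℝ) (s : Config M N) (u : Slot M)
    (a : {a : Slot M // a ∈ s}) : userValue P h s u ≤ actionValue P h s u a :=
  ciInf_le (Set.finite_range _).bddBelow a

lemma exists_actionValue_eq (P : Slot M → ℝ) (h : Config M (n + 1) → ℝ) (s : Config M (n + 1))
    (u : Slot M) : ∃ a, actionValue P h s u a = userValue P h s u :=
  exists_eq_ciInf_of_finite

lemma sum_mul_le_of_le (hP : P ∈ stdSimplex ℝ (Slot M)) {f : Slot M → ℝ} {C : ℝ}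
    (hf : ∀ y, f y ≤ C) : ∑ y, P y * f y ≤ C := by
  calc ∑ y, P y * f y ≤ ∑ y, P y * C :=
        Finset.sum_le_sum fun y _ => mul_le_mul_of_nonneg_left (hf y) (hP.1 y)
    _ = C := by rw [← Finset.sum_mul, hP.2, one_mul]

lemma sum_mul_lt_of_lt (hP : P ∈ stdSimplex ℝ (Slot M)) {f : Slot M → ℝ} {C : ℝ}
    (hf : ∀ y, f y < C) : ∑ y, P y * f y < C := by
  obtain ⟨y₀, -, hy₀⟩ := Finset.exists_max_image Finset.univ f Finset.univ_nonempty
  exact (sum_mul_le_of_le hP fun y => hy₀ y (Finset.mem_univ y)).trans_lt (hf y₀)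

lemma sum_mul_add_const (hP : P ∈ stdSimplex ℝ (Slot M)) (f : Slot M → ℝ) (C : ℝ) :
    ∑ y, P y * (f y + C) = ∑ y, P y * f y + C := by
  simp only [mul_add, Finset.sum_add_distrib, ← Finset.sum_mul, hP.2, one_mul]

/-- A weighted mean with positive weights attains an upper bound only if every term does. -/
lemma eq_of_sum_mul_eq (hP : P ∈ stdSimplex ℝ (Slot M)) (hP_pos : ∀ y, 0 < P y)
    {f : Slot M → ℝ} {C : ℝ} (hf : ∀ y, f y ≤ C) (h : C ≤ ∑ y, P y * f y) (y : Slot M) :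
    f y = C := by
  have h0 : ∑ y, P y * (C - f y) = 0 := by
    refine le_antisymm ?_
      (Finset.sum_nonneg fun y _ => mul_nonneg (hP.1 y) (sub_nonneg.2 (hf y)))
    simp only [mul_sub, Finset.sum_sub_distrib, ← Finset.sum_mul, hP.2, one_mul]
    linarith
  have := (Finset.sum_eq_zero_iff_of_nonneg fun y _ =>
    mul_nonneg (hP.1 y) (sub_nonneg.2 (hf y))).1 h0 y (Finset.mem_univ y)
  rcases mul_eq_zero.1 this with h | h
  · exact absurd h (hP_pos y).ne'
  · linarith

lemma nextValue_add_const (hP : P ∈ stdSimplex ℝ (Slot M)) (h : Config M N → ℝ) (C : ℝ)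
    (s : Config M N) (a : {a : Slot M // a ∈ s}) :
    nextValue P (fun s => h s + C) s a = nextValue P h s a + C :=
  sum_mul_add_const hP _ C

lemma nextValue_mono (hP : P ∈ stdSimplex ℝ (Slot M)) {h h' : Config M N → ℝ} (H : h ≤ h')
    (s : Config M N) (a : {a : Slot M // a ∈ s}) : nextValue P h s a ≤ nextValue P h' s a :=
  Finset.sum_le_sum fun y _ => mul_le_mul_of_nonneg_left (H _) (hP.1 y)

lemma bellman_add_const (hP : P ∈ stdSimplex ℝ (Slot M)) (hQ : Q ∈ stdSimplex ℝ (Slot M))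
    (h : Config M (n + 1) → ℝ) (C : ℝ) (s : Config M (n + 1)) :
    bellman P Q (fun s => h s + C) s = bellman P Q h s + C := by
  have : ∀ u, userValue P (fun s => h s + C) s u = userValue P h s u + C := fun u => by
    simp only [userValue, actionValue, nextValue_add_const hP, ← add_assoc]
    exact (ciInf_add (Set.finite_range _).bddBelow C).symm
  simp only [bellman, this]
  exact sum_mul_add_const hQ _ C

lemma bellman_mono (hP : P ∈ stdSimplex ℝ (Slot M)) (hQ : Q ∈ stdSimplex ℝ (Slot M))
    {h h' : Config M N → ℝ} (H : h ≤ h') (s : Config M N) :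
    bellman P Q h s ≤ bellman P Q h' s :=
  Finset.sum_le_sum fun u _ => mul_le_mul_of_nonneg_left
    (ciInf_mono (Set.finite_range _).bddBelow fun a =>
      add_le_add_right (nextValue_mono hP H s a) _) (hQ.1 u)

lemma lipschitzWith_bellman (hP : P ∈ stdSimplex ℝ (Slot M)) (hQ : Q ∈ stdSimplex ℝ (Slot M)) :
    LipschitzWith 1 (bellman P Q : (Config M (n + 1) → ℝ) → Config M (n + 1) → ℝ) := by
  refine LipschitzWith.of_dist_le_mul fun h h' => ?_
  rw [NNReal.coe_one, one_mul]
  refine (dist_pi_le_iff dist_nonneg).2 fun s => ?_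
  have key : ∀ f f' : Config M (n + 1) → ℝ, bellman P Q f s - bellman P Q f' s ≤ dist f f' := by
    intro f f'
    rw [sub_le_iff_le_add', ← bellman_add_const hP hQ]
    refine bellman_mono hP hQ (fun r => ?_) s
    have := (le_abs_self _).trans ((Real.dist_eq _ _).symm.le.trans (dist_le_pi_dist f f' r))
    linarith
  rw [Real.dist_eq]
  exact abs_sub_le_iff.2 ⟨key h h', by rw [dist_comm]; exact key h' h⟩

end Bellman

/-! ### Moving one driver -/

section Move

variable {M n : ℕ}

/-- Moving one driver changes `h` by at most the distance. -/
def IsMoveLipschitz (h : Config M (n + 1) → ℝ) : Prop :=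
  ∀ (t : Config M n) (u b : Slot M), h (b ::ₛ t) ≤ h (u ::ₛ t) + circleDist u b

lemma exists_abs_le_of_isMoveLipschitz (s₀ s : Config M (n + 1)) :
    ∃ C : ℝ, ∀ h, IsMoveLipschitz h → h s₀ = 0 → |h s| ≤ C := by
  refine forall_of_forall_move
    (p := fun s => ∃ C : ℝ, ∀ h, IsMoveLipschitz h → h s₀ = 0 → |h s| ≤ C)
    (fun t a y ⟨C, hC⟩ => ⟨C + circleDist a y, fun h hh h0 => ?_⟩)
    ⟨0, fun h _ h0 => by rw [h0, abs_zero]⟩ s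
  have h1 := hh t a y
  have h2 := hh t y a
  have h3 := abs_le.1 (hC h hh h0)
  rw [circleDist_comm] at h2
  exact abs_le.2 ⟨by linarith, by linarith⟩

variable [NeZero M] {P Q : Slot M → ℝ}

lemma nextValue_cons_self (P : Slot M → ℝ) (h : Config M (n + 1) → ℝ) (t : Config M n) (b : Slot M)
    (hb : b ∈ b ::ₛ t) : nextValue P h (b ::ₛ t) ⟨b, hb⟩ = ∑ y, P y * h (y ::ₛ t) :=
  Finset.sum_congr rfl fun y _ => by rw [replace_eq_of_cons rfl y]

lemma nextValue_cons_of_mem (P : Slot M → ℝ) (h : Config M (n + 1) → ℝ) {t : Config M n}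
    {c b : Slot M} (hc : c ∈ t) (hc' : c ∈ b ::ₛ t) :
    nextValue P h (b ::ₛ t) ⟨c, hc'⟩ = ∑ y, P y * h (b ::ₛ replace t ⟨c, hc⟩ y) :=
  Finset.sum_congr rfl fun y _ => by rw [replace_cons_of_mem hc hc' y]

/-- The drivers `b ::ₛ t` can imitate the drivers `u ::ₛ t`, the driver at `b` standing in for the
driver at `u`: either this driver is assigned now, which costs at most `circleDist u b` more, or the
two configurations still differ only in this driver after the stage. -/
lemma userValue_cons_le (hP : P ∈ stdSimplex ℝ (Slot M)) {h : Config M (n + 1) → ℝ} {u b : Slot M}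
    {C : ℝ} (hd : circleDist u b ≤ C) (hC : ∀ t : Config M n, h (b ::ₛ t) ≤ h (u ::ₛ t) + C)
    (t : Config M n) (v : Slot M) :
    userValue P h (b ::ₛ t) v ≤ userValue P h (u ::ₛ t) v + C := by
  obtain ⟨⟨c, hc⟩, hcv⟩ := exists_actionValue_eq P h (u ::ₛ t) v
  rw [← hcv]
  by_cases hcu : c = u
  · subst hcu
    refine (userValue_le h _ v ⟨b, Sym.mem_cons_self b t⟩).trans ?_
    rw [actionValue, actionValue, nextValue_cons_self, nextValue_cons_self]
    linarith [circleDist_triangle v c b]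
  · have hct : c ∈ t := (Sym.mem_cons.1 hc).resolve_left hcu
    refine (userValue_le h _ v ⟨c, Sym.mem_cons_of_mem hct⟩).trans ?_
    rw [actionValue, actionValue, nextValue_cons_of_mem P h hct, nextValue_cons_of_mem P h hct,
      add_assoc, ← sum_mul_add_const hP]
    gcongr with y
    · exact hP.1 y
    · exact hC _

/-! ### The discounted problem and the optimality equation -/

lemma exists_discounted_value (hP : P ∈ stdSimplex ℝ (Slot M)) (hQ : Q ∈ stdSimplex ℝ (Slot M))
    {β : NNReal} (hβ : β < 1) :
    ∃ V : Config M (n + 1) → ℝ, bellman P Q (fun s => β * V s) = V := by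
  have hc : ContractingWith β fun V : Config M (n + 1) → ℝ => bellman P Q ((β : ℝ) • V) := by
    refine ⟨hβ, ?_⟩
    have := (lipschitzWith_bellman (n := n) hP hQ).comp
      (lipschitzWith_smul (β := Config M (n + 1) → ℝ) (β : ℝ))
    rwa [one_mul, NNReal.nnnorm_eq] at this
  exact ⟨_, hc.fixedPoint_isFixedPt⟩

lemma isMoveLipschitz_of_discounted (hP : P ∈ stdSimplex ℝ (Slot M))
    (hQ : Q ∈ stdSimplex ℝ (Slot M)) {β : NNReal} (hβ : β < 1) {V : Config M (n + 1) → ℝ}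
    (hV : bellman P Q (fun s => β * V s) = V) : IsMoveLipschitz V := by
  -- Look at the move for which the inequality fails by the largest amount `D`.
  let f : Config M n × Slot M × Slot M → ℝ := fun x =>
    V (x.2.2 ::ₛ x.1) - V (x.2.1 ::ₛ x.1) - circleDist x.2.1 x.2.2
  obtain ⟨⟨t, u, b⟩, hx⟩ := Finite.exists_max f
  suffices h : f (t, u, b) ≤ 0 from fun t' u' b' => by
    have : V (b' ::ₛ t') - V (u' ::ₛ t') - circleDist u' b' ≤ 0 := (hx (t', u', b')).trans h
    linarith
  by_contra! hpos
  have hval : f (t, u, b) = V (b ::ₛ t) - V (u ::ₛ t) - circleDist u b := rfl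
  set D := f (t, u, b)
  have hd := circleDist_nonneg u b
  have hβ' : (β : ℝ) < 1 := by exact_mod_cast hβ
  let C := max (circleDist u b) (β * (circleDist u b + D))
  have hC : C < circleDist u b + D := max_lt (by linarith) (by nlinarith)
  have key := userValue_cons_le (P := P) (h := fun s => β * V s) (n := n) hP
    (le_max_left (circleDist u b) (β * (circleDist u b + D))) (fun t' => by
      have h1 : V (b ::ₛ t') - V (u ::ₛ t') - circleDist u b ≤ D := hx (t', u, b)
      calc (β : ℝ) * V (b ::ₛ t') ≤ β * (V (u ::ₛ t') + (circleDist u b + D)) := by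
            gcongr
            linarith
        _ ≤ β * V (u ::ₛ t') + C := by
            rw [mul_add]
            gcongr
            exact le_max_right _ _) t
  have h2 : bellman P Q (fun s => β * V s) (b ::ₛ t) ≤
      bellman P Q (fun s => β * V s) (u ::ₛ t) + C := by
    rw [bellman, bellman, ← sum_mul_add_const hQ]
    gcongr with v
    · exact hQ.1 v
    · exact key v
  rw [hV] at h2
  linarith

/-- The optimality equation of the average cost problem has a solution. It is the limit of the
values of the discounted problems, normalised to vanish at one configuration, as the discount factor
tends to `1`; these normalised values stay in a compact set because they change by at most the
distance when a driver moves. -/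
lemma exists_bellman_eq (hP : P ∈ stdSimplex ℝ (Slot M)) (hQ : Q ∈ stdSimplex ℝ (Slot M)) :
    ∃ (g : ℝ) (h : Config M (n + 1) → ℝ), ∀ s, bellman P Q h s = g + h s := by
  obtain ⟨β, -, hβ, hβlim⟩ := exists_seq_strictMono_tendsto' (zero_lt_one (α := NNReal))
  choose V hV using fun k => exists_discounted_value (n := n) hP hQ (hβ k).2
  let s₀ : Config M (n + 1) := Sym.replicate _ 0
  choose C hC using exists_abs_le_of_isMoveLipschitz (n := n) s₀
  let h : ℕ → Config M (n + 1) → ℝ := fun k s => V k s - V k s₀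
  have hmem : ∀ k, h k ∈ Set.univ.pi fun s => Set.Icc (-C s) (C s) := by
    intro k s _
    refine abs_le.1 (hC s (h k) (fun t u b => ?_) (sub_self _))
    have := isMoveLipschitz_of_discounted hP hQ (hβ k).2 (hV k) t u b
    simp only [h]
    linarith
  obtain ⟨h', -, φ, hφ, hlim⟩ :=
    (isCompact_univ_pi fun s => isCompact_Icc).tendsto_subseq hmem
  have heq : ∀ k s, bellman P Q (β k • h k) s = bellman P Q (β k • h k) s₀ + h k s := by
    intro k
    have h1 : β k • h k = fun s => (fun s => β k * V k s) s + -(β k * V k s₀) := by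
      ext s
      simp only [h, Pi.smul_apply, NNReal.smul_def, smul_eq_mul]
      ring
    intro s
    rw [h1, bellman_add_const hP hQ, bellman_add_const hP hQ, hV]
    simp only [h]
    ring
  have hcont : Continuous (bellman P Q : (Config M (n + 1) → ℝ) → Config M (n + 1) → ℝ) :=
    (lipschitzWith_bellman hP hQ).continuous
  have hlim' : Tendsto (fun k => bellman P Q (β (φ k) • h (φ k))) atTop
      (nhds (bellman P Q h')) := by
    refine (hcont.tendsto h').comp ?_
    simpa using (hβlim.comp hφ.tendsto_atTop).smul hlim
  refine ⟨bellman P Q h' s₀, h', fun s => tendsto_nhds_unique (tendsto_pi_nhds.1 hlim' s) ?_⟩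
  simp only [heq _ s]
  exact (tendsto_pi_nhds.1 hlim' s₀).add (tendsto_pi_nhds.1 hlim s)

/-! ### Moving a driver costs strictly less than the distance -/

/-- One step of the argument for `lt_of_bellman_eq`: if the excess of `h (b ::ₛ t) - h (u ::ₛ t)`
over the distance is maximal among all moves, then the driver `c` which is best for a user at `b`
when the drivers are at `u ::ₛ t` lies in `t` beyond `b` as seen from `u`, and moving a driver from
`u` to `c` has the same excess once `c` is replaced. -/
lemma exists_extend_of_max (hP : P ∈ stdSimplex ℝ (Slot M)) (hP_pos : ∀ x, 0 < P x)
    (hQ : Q ∈ stdSimplex ℝ (Slot M)) (hQ_pos : ∀ x, 0 < Q x)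
    {g : ℝ} {h : Config M (n + 1) → ℝ} (hh : ∀ s, bellman P Q h s = g + h s)
    {D : ℝ} (hD : 0 ≤ D)
    (hmax : ∀ (t : Config M n) (u b : Slot M), u ≠ b →
      h (b ::ₛ t) - h (u ::ₛ t) - circleDist u b ≤ D)
    {t : Config M n} {u b : Slot M} (hub : u ≠ b)
    (heq : h (b ::ₛ t) - h (u ::ₛ t) - circleDist u b = D) :
    ∃ (c : Slot M) (hc : c ∈ t), u ≠ c ∧ circleDist u c = circleDist u b + circleDist b c ∧
      ∀ y, h (c ::ₛ replace t ⟨c, hc⟩ y) - h (u ::ₛ replace t ⟨c, hc⟩ y) - circleDist u c = D := by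
  have hd := circleDist_pos hub
  -- Every user position contributes the same, in particular the position `b`.
  have hb : userValue P h (b ::ₛ t) b - userValue P h (u ::ₛ t) b = circleDist u b + D := by
    refine eq_of_sum_mul_eq hQ hQ_pos (C := circleDist u b + D)
      (f := fun v => userValue P h (b ::ₛ t) v - userValue P h (u ::ₛ t) v) (fun v => ?_) ?_ b
    · have := userValue_cons_le (h := h) (n := n) hP
        (show circleDist u b ≤ circleDist u b + D by linarith)
        (fun t' => by linarith [hmax t' u b hub]) t v
      linarith
    · have h1 := hh (b ::ₛ t)
      have h2 := hh (u ::ₛ t)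
      simp only [bellman] at h1 h2
      simp only [mul_sub, Finset.sum_sub_distrib]
      linarith
  -- With the drivers `b ::ₛ t`, this user can be served at no cost.
  have hbb := userValue_le (P := P) h (b ::ₛ t) b ⟨b, Sym.mem_cons_self b t⟩
  rw [actionValue, nextValue_cons_self, circleDist_self] at hbb
  obtain ⟨⟨c, hc⟩, hcv⟩ := exists_actionValue_eq P h (u ::ₛ t) b
  rw [← hcv] at hb
  by_cases hcu : c = u
  · subst hcu
    rw [actionValue, nextValue_cons_self] at hb
    have := circleDist_nonneg b c
    linarith
  have hct : c ∈ t := (Sym.mem_cons.1 hc).resolve_left hcu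
  rw [actionValue, nextValue_cons_of_mem P h hct] at hb
  have hsum : ∑ y, P y * h (y ::ₛ t) = ∑ y, P y * h (c ::ₛ replace t ⟨c, hct⟩ y) := by
    simp only [cons_replace hct]
  rw [hsum] at hbb
  have htri := circleDist_triangle u b c
  have hle : ∀ y, h (c ::ₛ replace t ⟨c, hct⟩ y) - h (u ::ₛ replace t ⟨c, hct⟩ y) ≤
      circleDist u b + circleDist b c + D := fun y => by
    linarith [hmax (replace t ⟨c, hct⟩ y) u c (Ne.symm hcu)]
  have hy := eq_of_sum_mul_eq hP hP_pos hle (by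
    simp only [mul_sub, Finset.sum_sub_distrib]
    linarith)
  have hdist : circleDist u c = circleDist u b + circleDist b c := by
    linarith [hmax (replace t ⟨c, hct⟩ u) u c (Ne.symm hcu), hy u]
  exact ⟨c, hct, Ne.symm hcu, hdist, fun y => by linarith [hy y]⟩

/-- A solution of the optimality equation changes by strictly less than the distance when a driver
moves. Otherwise take a move from `u` to `b` of maximal excess over the distance, among those one of
maximal distance, and among those one with as few other drivers at `b` as possible. By
`exists_extend_of_max` there is another driver at `b`, and replacing it by a driver at `u` gives a
move of the same excess and distance with fewer other drivers at `b`. -/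
lemma lt_of_bellman_eq (hP : P ∈ stdSimplex ℝ (Slot M)) (hP_pos : ∀ x, 0 < P x)
    (hQ : Q ∈ stdSimplex ℝ (Slot M)) (hQ_pos : ∀ x, 0 < Q x)
    {g : ℝ} {h : Config M (n + 1) → ℝ} (hh : ∀ s, bellman P Q h s = g + h s)
    (t : Config M n) {u b : Slot M} (hub : u ≠ b) :
    h (b ::ₛ t) < h (u ::ₛ t) + circleDist u b := by
  classical
  by_contra! hcon
  let f : Config M n × Slot M × Slot M → ℝ := fun x =>
    h (x.2.2 ::ₛ x.1) - h (x.2.1 ::ₛ x.1) - circleDist x.2.1 x.2.2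
  obtain ⟨x, hxS, hx⟩ := (Finset.univ.filter fun x : Config M n × Slot M × Slot M =>
    x.2.1 ≠ x.2.2).exists_max_image f ⟨(t, u, b), by simpa using hub⟩
  have hmax : ∀ (t : Config M n) (u b : Slot M), u ≠ b →
      h (b ::ₛ t) - h (u ::ₛ t) - circleDist u b ≤ f x :=
    fun t u b hub => hx (t, u, b) (by simpa using hub)
  have hD : 0 ≤ f x := le_trans (by linarith) (hmax t u b hub)
  obtain ⟨x₁, hx₁S, hx₁⟩ := (Finset.univ.filter fun x' : Config M n × Slot M × Slot M =>
    x'.2.1 ≠ x'.2.2 ∧ f x' = f x).exists_max_image (fun x => circleDist x.2.1 x.2.2)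
    ⟨x, by simpa using hxS⟩
  obtain ⟨⟨t₂, u₂, b₂⟩, hx₂S, hx₂⟩ := (Finset.univ.filter fun x' : Config M n × Slot M × Slot M =>
    (x'.2.1 ≠ x'.2.2 ∧ f x' = f x) ∧ circleDist x'.2.1 x'.2.2 = circleDist x₁.2.1 x₁.2.2
    ).exists_min_image (fun x => (x.1 : Multiset (Slot M)).count x.2.2)
    ⟨x₁, by simpa using hx₁S⟩
  simp only [Finset.mem_filter, Finset.mem_univ, true_and] at hx₁ hx₂S hx₂
  obtain ⟨⟨hne, hval⟩, hdist⟩ := hx₂S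
  obtain ⟨c, hc, huc, hdc, hy⟩ := exists_extend_of_max hP hP_pos hQ hQ_pos hh hD hmax hne hval
  obtain rfl : b₂ = c := by
    by_contra hbc
    have := hx₁ (replace t₂ ⟨c, hc⟩ u₂, u₂, c) ⟨huc, hy u₂⟩
    linarith [circleDist_pos hbc]
  have hcount := hx₂ (replace t₂ ⟨b₂, hc⟩ u₂, u₂, b₂) ⟨⟨hne, hy u₂⟩, hdist⟩
  have hlt : Multiset.count b₂ (replace t₂ ⟨b₂, hc⟩ u₂ : Multiset (Slot M)) <
      Multiset.count b₂ (t₂ : Multiset (Slot M)) := by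
    have hpos := Multiset.count_pos.2 (show b₂ ∈ (t₂ : Multiset (Slot M)) from hc)
    change Multiset.count b₂ (u₂ ::ₘ (t₂ : Multiset (Slot M)).erase b₂) < _
    rw [Multiset.count_cons_of_ne hne.symm, Multiset.count_erase_self]
    omega
  exact absurd hcount (not_le.2 hlt)

end Move

/-! ### Optimal policies -/

section Average

variable {M N n : ℕ} [NeZero M] {P Q : Slot M → ℝ}

/-- The future values after the assignment of one or the other of two drivers differ by less than
the distance of these drivers. -/
lemma nextValue_lt (hP : P ∈ stdSimplex ℝ (Slot M)) {h : Config M (n + 1) → ℝ}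
    (hlt : ∀ (t : Config M n) (u b : Slot M), u ≠ b →
      h (b ::ₛ t) < h (u ::ₛ t) + circleDist u b)
    (s : Config M (n + 1)) {a b : {a : Slot M // a ∈ s}} (hab : a.1 ≠ b.1) :
    nextValue P h s a < nextValue P h s b + circleDist a.1 b.1 := by
  obtain ⟨a, ha⟩ := a
  obtain ⟨b, hb⟩ := b
  obtain ⟨t, rfl⟩ := Sym.exists_cons_of_mem ha
  have hbt : b ∈ t := (Sym.mem_cons.1 hb).resolve_left (Ne.symm hab)
  rw [nextValue_cons_self, nextValue_cons_of_mem P h hbt, ← sub_lt_iff_lt_add',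
    ← Finset.sum_sub_distrib]
  simp only [← mul_sub, ← cons_replace hbt]
  exact sum_mul_lt_of_lt hP fun y => by linarith [hlt (replace t ⟨b, hbt⟩ y) a b hab]

/-- If `a` lies on a shortest path from the user to `b`, then assigning `b` is worse than assigning
`a`, unless the two drivers are in the same slot. -/
lemma eq_of_actionValue_le (hP : P ∈ stdSimplex ℝ (Slot M)) {h : Config M (n + 1) → ℝ}
    (hlt : ∀ (t : Config M n) (u b : Slot M), u ≠ b →
      h (b ::ₛ t) < h (u ::ₛ t) + circleDist u b)
    (s : Config M (n + 1)) (u : Slot M) {a b : {a : Slot M // a ∈ s}}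
    (hle : actionValue P h s u b ≤ actionValue P h s u a)
    (hd : circleDist u b.1 = circleDist u a.1 + circleDist a.1 b.1) : b.1 = a.1 := by
  by_contra hne
  have := nextValue_lt hP hlt s (Ne.symm hne)
  rw [actionValue, actionValue] at hle
  linarith

/-- The expected loss of the policy `ρ` in one stage, in comparison with the best actions for the
value function `h`. -/
noncomputable def slack (P Q : Slot M → ℝ) (h : Config M N → ℝ) (ρ : Policy M N)
    (s : Config M N) : ℝ :=
  ∑ u, Q u * (actionValue P h s u (ρ s u) - userValue P h s u)

lemma slack_nonneg (hQ : Q ∈ stdSimplex ℝ (Slot M)) (h : Config M N → ℝ) (ρ : Policy M N)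
    (s : Config M N) : 0 ≤ slack P Q h ρ s :=
  Finset.sum_nonneg fun u _ => mul_nonneg (hQ.1 u) (sub_nonneg.2 (userValue_le h s u _))

lemma actionValue_eq_of_slack_eq_zero (hQ : Q ∈ stdSimplex ℝ (Slot M)) (hQ_pos : ∀ x, 0 < Q x)
    {h : Config M N → ℝ} {ρ : Policy M N} {s : Config M N} (h0 : slack P Q h ρ s = 0)
    (u : Slot M) : actionValue P h s u (ρ s u) = userValue P h s u := by
  have := (Finset.sum_eq_zero_iff_of_nonneg fun u _ =>
    mul_nonneg (hQ.1 u) (sub_nonneg.2 (userValue_le h s u (ρ s u)))).1 h0 u (Finset.mem_univ u)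
  exact sub_eq_zero.1 ((mul_eq_zero.1 this).resolve_left (hQ_pos u).ne')

lemma transition_mulVec (P Q : Slot M → ℝ) (ρ : Policy M N) (f : Config M N → ℝ)
    (s : Config M N) :
    (transition P Q ρ).mulVec f s = ∑ u, Q u * nextValue P f s (ρ s u) := by
  simp only [Matrix.mulVec, dotProduct, transition, nextValue, Finset.sum_mul, Finset.mul_sum]
  rw [Finset.sum_comm]
  refine Finset.sum_congr rfl fun u _ => ?_
  rw [Finset.sum_comm]
  refine Finset.sum_congr rfl fun y _ => ?_
  simp [ite_mul, mul_assoc]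

lemma transition_nonneg (hP : P ∈ stdSimplex ℝ (Slot M)) (hQ : Q ∈ stdSimplex ℝ (Slot M))
    (ρ : Policy M N) (s s' : Config M N) : 0 ≤ transition P Q ρ s s' :=
  Finset.sum_nonneg fun u _ => Finset.sum_nonneg fun y _ => by
    split_ifs
    · exact mul_nonneg (hQ.1 u) (hP.1 y)
    · exact le_rfl

lemma transition_pos (hP_pos : ∀ x, 0 < P x) (hQ_pos : ∀ x, 0 < Q x) (ρ : Policy M N)
    (s : Config M N) (u y : Slot M) : 0 < transition P Q ρ s (replace s (ρ s u) y) := by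
  have hnn : ∀ u' y', 0 ≤ if replace s (ρ s u') y' = replace s (ρ s u) y then Q u' * P y' else 0 :=
    fun u' y' => by
      split_ifs
      · exact (mul_pos (hQ_pos u') (hP_pos y')).le
      · exact le_rfl
  refine Finset.sum_pos' (fun u' _ => Finset.sum_nonneg fun y' _ => hnn u' y')
    ⟨u, Finset.mem_univ u, Finset.sum_pos' (fun y' _ => hnn u y') ⟨y, Finset.mem_univ y, ?_⟩⟩
  rw [if_pos rfl]
  exact mul_pos (hQ_pos u) (hP_pos y)

lemma transition_mem_rowStochastic (hP : P ∈ stdSimplex ℝ (Slot M))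
    (hQ : Q ∈ stdSimplex ℝ (Slot M)) (ρ : Policy M N) :
    transition P Q ρ ∈ Matrix.rowStochastic ℝ (Config M N) := by
  refine Matrix.mem_rowStochastic.2 ⟨transition_nonneg hP hQ ρ, funext fun s => ?_⟩
  simp [transition_mulVec, nextValue, hP.2, hQ.2]

lemma abs_mulVec_le {A : Matrix (Config M N) (Config M N) ℝ}
    (hA : A ∈ Matrix.rowStochastic ℝ (Config M N)) {f : Config M N → ℝ} {C : ℝ}
    (hf : ∀ s, |f s| ≤ C) (s : Config M N) : |A.mulVec f s| ≤ C := by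
  obtain ⟨hnn, h1⟩ := Matrix.mem_rowStochastic_iff_sum.1 hA
  calc |∑ s', A s s' * f s'| ≤ ∑ s', A s s' * C := by
        refine (Finset.abs_sum_le_sum_abs _ _).trans (Finset.sum_le_sum fun s' _ => ?_)
        rw [abs_mul, abs_of_nonneg (hnn s s')]
        exact mul_le_mul_of_nonneg_left (hf s') (hnn s s')
    _ = C := by rw [← Finset.sum_mul, h1 s, one_mul]

lemma stageCost_eq {g : ℝ} {h : Config M N → ℝ} (hh : ∀ s, bellman P Q h s = g + h s)
    (ρ : Policy M N) : stageCost Q ρ =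
      g • 1 + (h - (transition P Q ρ).mulVec h) + slack P Q h ρ := by
  ext s
  have h1 := hh s
  simp only [Pi.add_apply, Pi.sub_apply, Pi.smul_apply, Pi.one_apply, smul_eq_mul, mul_one,
    transition_mulVec, stageCost, slack, bellman, actionValue, mul_sub, mul_add,
    Finset.sum_sub_distrib, Finset.sum_add_distrib] at h1 ⊢
  linarith

/-- The total cost of the first `T` stages is `T` times the optimal gain, up to the bounded change
of the value function and the accumulated slack of the policy. -/
lemma sum_expectedCost (hP : P ∈ stdSimplex ℝ (Slot M)) (hQ : Q ∈ stdSimplex ℝ (Slot M))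
    {g : ℝ} {h : Config M N → ℝ} (hh : ∀ s, bellman P Q h s = g + h s)
    (ρ : Policy M N) (s₀ : Config M N) (T : ℕ) :
    ∑ t ∈ Finset.range T, expectedCost P Q ρ s₀ t = T * g +
      (h s₀ - (transition P Q ρ ^ T).mulVec h s₀) +
      ∑ t ∈ Finset.range T, (transition P Q ρ ^ t).mulVec (slack P Q h ρ) s₀ := by
  induction T with
  | zero => simp
  | succ T ih =>
    have h1 : expectedCost P Q ρ s₀ T = (transition P Q ρ ^ T).mulVec (stageCost Q ρ) s₀ := rfl
    have h2 := (Matrix.mem_rowStochastic.1 (pow_mem (transition_mem_rowStochastic hP hQ ρ) T)).2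
    rw [Finset.sum_range_succ, Finset.sum_range_succ, ih, h1, stageCost_eq hh, Matrix.mulVec_add,
      Matrix.mulVec_add, Matrix.mulVec_sub, Matrix.mulVec_smul, h2, Matrix.mulVec_mulVec,
      ← pow_succ]
    simp only [Pi.add_apply, Pi.sub_apply, Pi.smul_apply, Pi.one_apply, smul_eq_mul, mul_one]
    push_cast
    ring

lemma tendsto_value_div (hP : P ∈ stdSimplex ℝ (Slot M)) (hQ : Q ∈ stdSimplex ℝ (Slot M))
    (h : Config M N → ℝ) (ρ : Policy M N) (s₀ : Config M N) :
    Tendsto (fun T : ℕ => (h s₀ - (transition P Q ρ ^ T).mulVec h s₀) / T) atTop (nhds 0) := by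
  obtain ⟨s₁, hs₁⟩ := haveI : Nonempty (Config M N) := ⟨s₀⟩; Finite.exists_max fun s => |h s|
  refine squeeze_zero_norm (a := fun T : ℕ => (2 * |h s₁|) / T) (fun T => ?_)
    (tendsto_const_div_atTop_nhds_zero_nat _)
  rw [norm_div, Real.norm_natCast, Real.norm_eq_abs]
  gcongr
  have := abs_mulVec_le (pow_mem (transition_mem_rowStochastic hP hQ ρ) T) hs₁ s₀
  linarith [abs_sub (h s₀) ((transition P Q ρ ^ T).mulVec h s₀), hs₁ s₀]

lemma averageCost_eq_of_slack_eq_zero (hP : P ∈ stdSimplex ℝ (Slot M))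
    (hQ : Q ∈ stdSimplex ℝ (Slot M)) {g : ℝ} {h : Config M N → ℝ}
    (hh : ∀ s, bellman P Q h s = g + h s) {ρ : Policy M N} (hρ : slack P Q h ρ = 0)
    (s₀ : Config M N) : averageCost P Q ρ s₀ = g := by
  refine Tendsto.limsup_eq ?_
  have := (tendsto_value_div hP hQ h ρ s₀).const_add g
  rw [add_zero] at this
  refine this.congr' ?_
  filter_upwards [eventually_gt_atTop 0] with T hT
  have hT' : (T : ℝ) ≠ 0 := by positivity
  rw [sum_expectedCost hP hQ hh, hρ]
  simp only [Matrix.mulVec_zero, Pi.zero_apply, Finset.sum_const_zero]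
  field_simp
  ring

lemma averageCost_le_of_isOptimal (hP : P ∈ stdSimplex ℝ (Slot M))
    (hQ : Q ∈ stdSimplex ℝ (Slot M)) {g : ℝ} {h : Config M (n + 1) → ℝ}
    (hh : ∀ s, bellman P Q h s = g + h s) {ρ : Policy M (n + 1)} {s₀ : Config M (n + 1)}
    (hρ : IsOptimal P Q s₀ ρ) : averageCost P Q ρ s₀ ≤ g := by
  -- The policy that takes a best action everywhere has average cost `g`.
  choose ρ' hρ' using exists_actionValue_eq (n := n) P h
  refine (hρ ρ').trans (averageCost_eq_of_slack_eq_zero hP hQ hh (funext fun s => ?_) s₀).le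
  simp [slack, hρ']

/-- The mean over the first `T` stages of the distribution of the drivers. -/
noncomputable def occupation (P Q : Slot M → ℝ) (ρ : Policy M N) (s₀ : Config M N) (T : ℕ)
    (s : Config M N) : ℝ :=
  (∑ t ∈ Finset.range T, (transition P Q ρ ^ t) s₀ s) / T

lemma occupation_mem_stdSimplex (hP : P ∈ stdSimplex ℝ (Slot M))
    (hQ : Q ∈ stdSimplex ℝ (Slot M)) (ρ : Policy M N) (s₀ : Config M N) {T : ℕ} (hT : T ≠ 0) :
    occupation P Q ρ s₀ T ∈ stdSimplex ℝ (Config M N) := by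
  have h := fun t => Matrix.mem_rowStochastic_iff_sum.1
    (pow_mem (transition_mem_rowStochastic hP hQ ρ) t)
  refine ⟨fun s => div_nonneg (Finset.sum_nonneg fun t _ => (h t).1 s₀ s) (Nat.cast_nonneg T), ?_⟩
  simp only [occupation]
  rw [← Finset.sum_div, Finset.sum_comm, Finset.sum_congr rfl fun t _ => (h t).2 s₀]
  simp [hT]

lemma occupation_dotProduct (ρ : Policy M N) (s₀ : Config M N) (T : ℕ) (f : Config M N → ℝ) :
    occupation P Q ρ s₀ T ⬝ᵥ f =
      (∑ t ∈ Finset.range T, (transition P Q ρ ^ t).mulVec f s₀) / T := by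
  simp only [dotProduct, occupation, Matrix.mulVec, div_mul_eq_mul_div, ← Finset.sum_div,
    Finset.sum_mul]
  rw [Finset.sum_comm]

/-- Under an optimal policy there is a stationary distribution of the drivers for which the slack
vanishes almost surely: any limit of the mean occupations. -/
lemma exists_stationary (hP : P ∈ stdSimplex ℝ (Slot M)) (hQ : Q ∈ stdSimplex ℝ (Slot M))
    {g : ℝ} {h : Config M (n + 1) → ℝ} (hh : ∀ s, bellman P Q h s = g + h s)
    {ρ : Policy M (n + 1)} {s₀ : Config M (n + 1)} (hρ : IsOptimal P Q s₀ ρ) :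
    ∃ π ∈ stdSimplex ℝ (Config M (n + 1)), π ⬝ᵥ slack P Q h ρ = 0 ∧
      ∀ f, π ⬝ᵥ (transition P Q ρ).mulVec f = π ⬝ᵥ f := by
  obtain ⟨π, hπ, φ, hφ, hlim⟩ := (isCompact_stdSimplex ℝ (Config M (n + 1))).tendsto_subseq
    fun k => occupation_mem_stdSimplex hP hQ ρ s₀ (Nat.succ_ne_zero k)
  have hT : Tendsto (fun k => (φ k).succ) atTop atTop :=
    (tendsto_add_atTop_nat 1).comp hφ.tendsto_atTop
  have hdot : ∀ f, Tendsto (fun k => occupation P Q ρ s₀ (φ k).succ ⬝ᵥ f) atTop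
      (nhds (π ⬝ᵥ f)) := fun f =>
    ((continuous_id.dotProduct continuous_const).tendsto π).comp hlim
  refine ⟨π, hπ, le_antisymm (le_of_forall_pos_le_add fun ε hε => ?_) ?_, fun f => ?_⟩
  · have hbdd : IsBoundedUnder (· ≤ ·) atTop fun T : ℕ =>
        (∑ t ∈ Finset.range T, expectedCost P Q ρ s₀ t) / T := by
      obtain ⟨s₁, hs₁⟩ := haveI : Nonempty (Config M (n + 1)) := ⟨s₀⟩
        Finite.exists_max fun s => |stageCost Q ρ s|
      refine ⟨|stageCost Q ρ s₁|, eventually_map.2 ?_⟩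
      filter_upwards [eventually_gt_atTop 0] with T hT
      rw [div_le_iff₀ (Nat.cast_pos.2 hT)]
      calc ∑ t ∈ Finset.range T, expectedCost P Q ρ s₀ t
          ≤ ∑ t ∈ Finset.range T, |stageCost Q ρ s₁| := Finset.sum_le_sum fun t _ =>
            (le_abs_self _).trans
              (abs_mulVec_le (pow_mem (transition_mem_rowStochastic hP hQ ρ) t) hs₁ s₀)
        _ = |stageCost Q ρ s₁| * T := by simp [mul_comm]
    have hev := eventually_lt_of_limsup_lt
      ((averageCost_le_of_isOptimal hP hQ hh hρ).trans_lt (lt_add_of_pos_right g hε)) hbdd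
    have hup := (tendsto_value_div hP hQ h ρ s₀).const_sub ε
    rw [sub_zero] at hup
    rw [zero_add]
    refine le_of_tendsto_of_tendsto (hdot _) (hup.comp hT) ?_
    filter_upwards [hT.eventually hev] with k hk
    have hpos : (0 : ℝ) < (φ k).succ := Nat.cast_pos.2 (Nat.succ_pos _)
    rw [sum_expectedCost hP hQ hh, add_div, add_div, mul_div_cancel_left₀ _ hpos.ne'] at hk
    rw [occupation_dotProduct]
    simp only [Function.comp_apply]
    linarith
  · exact dotProduct_nonneg_of_nonneg (fun s => hπ.1 s) fun s => slack_nonneg hQ h ρ s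
  · refine tendsto_nhds_unique (hdot _) ?_
    have := (hdot f).sub ((tendsto_value_div hP hQ f ρ s₀).comp hT)
    rw [sub_zero] at this
    refine this.congr fun k => ?_
    simp only [Function.comp_apply, occupation_dotProduct, ← sub_div, Matrix.mulVec_mulVec,
      ← pow_succ]
    have h1 := Finset.sum_range_succ' (fun t => (transition P Q ρ ^ t).mulVec f s₀) (φ k).succ
    rw [Finset.sum_range_succ] at h1
    rw [pow_zero, Matrix.one_mulVec] at h1
    congr 1
    linarith

/-- Every action of an optimal policy is a best one for the value function. On the support of a
stationary distribution the slack vanishes, hence a driver is assigned to a user in the same slot.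
This allows any driver to be moved anywhere with positive probability, so that the support is the
set of all configurations. -/
lemma actionValue_eq_of_isOptimal (hP : P ∈ stdSimplex ℝ (Slot M)) (hP_pos : ∀ x, 0 < P x)
    (hQ : Q ∈ stdSimplex ℝ (Slot M)) (hQ_pos : ∀ x, 0 < Q x)
    {g : ℝ} {h : Config M (n + 1) → ℝ} (hh : ∀ s, bellman P Q h s = g + h s)
    {ρ : Policy M (n + 1)} {s₀ : Config M (n + 1)} (hρ : IsOptimal P Q s₀ ρ)
    (s : Config M (n + 1)) (u : Slot M) :
    actionValue P h s u (ρ s u) = userValue P h s u := by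
  obtain ⟨π, hπ, hslack, hstat⟩ := exists_stationary hP hQ hh hρ
  have hzero : ∀ s, 0 < π s → slack P Q h ρ s = 0 := fun s hs =>
    (mul_eq_zero.1 ((Finset.sum_eq_zero_iff_of_nonneg fun s _ =>
      mul_nonneg (hπ.1 s) (slack_nonneg hQ h ρ s)).1 hslack s (Finset.mem_univ s))).resolve_left
      hs.ne'
  obtain ⟨s₁, -, hs₁⟩ : ∃ s₁ ∈ Finset.univ, 0 < π s₁ :=
    Finset.exists_lt_of_sum_lt (by rw [hπ.2]; simp)
  have hpos : ∀ s, 0 < π s := by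
    refine forall_of_forall_move (fun t a y hat => ?_) hs₁
    have hmin := actionValue_eq_of_slack_eq_zero hQ hQ_pos (hzero _ hat) a
    have hown : (ρ (a ::ₛ t) a).1 = a :=
      eq_of_actionValue_le hP (fun t _ _ hub => lt_of_bellman_eq hP hP_pos hQ hQ_pos hh t hub) _ a
        (a := ⟨a, Sym.mem_cons_self a t⟩) (hmin.trans_le (userValue_le h _ a _)) (by simp)
    have htr := transition_pos hP_pos hQ_pos ρ (a ::ₛ t) a y
    rw [replace_eq_of_cons (by rw [hown])] at htr
    have h1 := hstat (Pi.single (y ::ₛ t) 1)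
    rw [dotProduct_single_one, Matrix.mulVec_single_one] at h1
    rw [← h1]
    exact Finset.sum_pos' (fun s _ => mul_nonneg (hπ.1 s) (transition_nonneg hP hQ ρ _ _))
      ⟨a ::ₛ t, Finset.mem_univ _, mul_pos hat htr⟩
  exact actionValue_eq_of_slack_eq_zero hQ hQ_pos (hzero s (hpos s)) u

end Average

/-! ### Neighbours and greedy actions -/

section Greedy

variable {M n : ℕ} [NeZero M] {P Q : Slot M → ℝ}

lemma isGreedyAt_of_le_neighbours {ρ : Policy M n} {s : Config M n} {u : Slot M}
    (hR : circleDist u (ρ s u).1 ≤ circleDist u (rightNeighbour u s))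
    (hL : circleDist u (ρ s u).1 ≤ circleDist u (leftNeighbour u s)) : IsGreedyAt ρ s u := by
  intro b hb
  rcases circleDist_eq_add_neighbour hb u with h | h
  · linarith [circleDist_nonneg (rightNeighbour u s) b]
  · linarith [circleDist_nonneg (leftNeighbour u s) b]

/-- If the policy prefers the farther of two neighbouring drivers for the user `u`, then it prefers
this driver all the more for the mirror image of `u`, to which this driver is the nearer one. -/
lemma isGreedyAt_reflection {h : Config M n → ℝ} {ρ : Policy M n} {s : Config M n}
    (hmin : ∀ u, actionValue P h s u (ρ s u) = userValue P h s u)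
    (hρ : ∀ u, (ρ s u).1 = rightNeighbour u s ∨ (ρ s u).1 = leftNeighbour u s)
    {u : Slot M} (hu : ¬ IsGreedyAt ρ s u) : IsGreedyAt ρ s (reflection s u) := by
  have ha := (ρ s u).2
  obtain ⟨hR, hL⟩ := neighbours_reflection ha u
  have hRm := rightNeighbour_mem ha u
  have hLm := leftNeighbour_mem ha u
  have hdR : circleDist (reflection s u) (rightNeighbour u s) =
      circleDist u (leftNeighbour u s) := by
    rw [circleDist_comm]
    exact circleDist_congr (by rw [reflection]; ring)
  have hdL : circleDist (reflection s u) (leftNeighbour u s) =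
      circleDist u (rightNeighbour u s) := by
    rw [circleDist_comm]
    exact circleDist_congr (by rw [reflection]; ring)
  have hminR := (hmin u).trans_le (userValue_le h s u ⟨_, hRm⟩)
  have hminL := (hmin u).trans_le (userValue_le h s u ⟨_, hLm⟩)
  have hminR' := (hmin (reflection s u)).trans_le (userValue_le h s _ ⟨_, hRm⟩)
  have hminL' := (hmin (reflection s u)).trans_le (userValue_le h s _ ⟨_, hLm⟩)
  have hρ' := hρ (reflection s u)
  rw [hR, hL] at hρ'
  have hact : ∀ (v a : Slot M) (ham : a ∈ s),
      actionValue P h s v ⟨a, ham⟩ = circleDist v a + nextValue P h s ⟨a, ham⟩ :=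
    fun _ _ _ => rfl
  have hng := mt (fun H : _ ∧ _ => isGreedyAt_of_le_neighbours H.1 H.2) hu
  rw [not_and_or, not_le, not_le] at hng
  have hgoal := isGreedyAt_of_le_neighbours (ρ := ρ) (s := s) (u := reflection s u)
  rw [hR, hL] at hgoal
  rcases hρ u with h1 | h1 <;> rcases hρ' with h2 | h2 <;>
    simp only [hact, h1, h2, hdR, hdL] at hminR hminL hminR' hminL' hng hgoal <;>
    apply hgoal <;> rcases hng with hng | hng <;> linarith

/-- Reflection maps the users that are not served greedily injectively to users that are. -/
lemma le_two_mul_ncard_isGreedyAt {ρ : Policy M n} {s : Config M n}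
    (hrefl : ∀ u, ¬ IsGreedyAt ρ s u → IsGreedyAt ρ s (reflection s u)) :
    M ≤ 2 * {u : Slot M | IsGreedyAt ρ s u}.ncard := by
  have hle : {u : Slot M | IsGreedyAt ρ s u}ᶜ.ncard ≤ {u : Slot M | IsGreedyAt ρ s u}.ncard :=
    Set.ncard_le_ncard_of_injOn (reflection s) hrefl (reflection_injective (ρ s 0).2).injOn
  have := Set.ncard_add_ncard_compl {u : Slot M | IsGreedyAt ρ s u}
  rw [Nat.card_zmod] at this
  omega

lemma card_le_two_mul_ncard_isGreedyAt {ρ : Policy M n}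
    (hρ : ∀ s, M ≤ 2 * {u : Slot M | IsGreedyAt ρ s u}.ncard) :
    Nat.card (Config M n × Slot M) ≤
      2 * {p : Config M n × Slot M | IsGreedyAt ρ p.1 p.2}.ncard := by
  have e : {p : Config M n × Slot M | IsGreedyAt ρ p.1 p.2} ≃
      (s : Config M n) × {u : Slot M | IsGreedyAt ρ s u} :=
    { toFun := fun p => ⟨p.1.1, p.1.2, p.2⟩
      invFun := fun q => ⟨(q.1, q.2.1), q.2.2⟩
      left_inv := fun _ => rfl
      right_inv := fun _ => rfl }
  rw [← Nat.card_coe_set_eq, Nat.card_congr e, Nat.card_sigma, Nat.card_prod, Nat.card_zmod,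
    Finset.mul_sum, Nat.card_eq_fintype_card, ← Finset.card_univ, ← smul_eq_mul]
  exact Finset.card_nsmul_le_sum _ _ _ fun s _ => hρ s

end Greedy

end CircleMatching

theorem mainTheorem2 (M N : ℕ) [NeZero M]
    (P Q : CircleMatching.Slot M → ℝ)
    (hP : P ∈ stdSimplex ℝ (CircleMatching.Slot M)) (hP_pos : ∀ x, 0 < P x)
    (hQ : Q ∈ stdSimplex ℝ (CircleMatching.Slot M)) (hQ_pos : ∀ x, 0 < Q x)
    (s₀ : CircleMatching.Config M N) (ρ : CircleMatching.Policy M N)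
    (hρ : CircleMatching.IsOptimal P Q s₀ ρ) :
    (∀ (s : CircleMatching.Config M N) (u : CircleMatching.Slot M),
      (ρ s u).1 = CircleMatching.rightNeighbour u s ∨
        (ρ s u).1 = CircleMatching.leftNeighbour u s) ∧
    (∀ s : CircleMatching.Config M N,
      M ≤ 2 * {u : CircleMatching.Slot M | CircleMatching.IsGreedyAt ρ s u}.ncard) ∧
    Nat.card (CircleMatching.Config M N × CircleMatching.Slot M) ≤
      2 * {p : CircleMatching.Config M N × CircleMatching.Slot M |
        CircleMatching.IsGreedyAt ρ p.1 p.2}.ncard := by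
  suffices h : (∀ s u, (ρ s u).1 = CircleMatching.rightNeighbour u s ∨
      (ρ s u).1 = CircleMatching.leftNeighbour u s) ∧
      ∀ s, M ≤ 2 * {u : CircleMatching.Slot M | CircleMatching.IsGreedyAt ρ s u}.ncard from
    ⟨h.1, h.2, CircleMatching.card_le_two_mul_ncard_isGreedyAt h.2⟩
  -- Without drivers there is no policy.
  obtain _ | n := N
  · exact absurd (ρ s₀ 0).2 (by rw [s₀.eq_nil_of_card_zero]; exact Sym.notMem_nil _)
  obtain ⟨g, h, hh⟩ := CircleMatching.exists_bellman_eq (n := n) hP hQ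
  have hmin := CircleMatching.actionValue_eq_of_isOptimal hP hP_pos hQ hQ_pos hh hρ
  have hnb : ∀ s u, (ρ s u).1 = CircleMatching.rightNeighbour u s ∨
      (ρ s u).1 = CircleMatching.leftNeighbour u s := fun s u =>
    (CircleMatching.circleDist_eq_add_neighbour (ρ s u).2 u).imp
      (CircleMatching.eq_of_actionValue_le hP
        (fun t _ _ hub => CircleMatching.lt_of_bellman_eq hP hP_pos hQ hQ_pos hh t hub) s u
        (a := ⟨_, CircleMatching.rightNeighbour_mem (ρ s u).2 u⟩)
        ((hmin s u).trans_le (CircleMatching.userValue_le h s u _)))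
      (CircleMatching.eq_of_actionValue_le hP
        (fun t _ _ hub => CircleMatching.lt_of_bellman_eq hP hP_pos hQ hQ_pos hh t hub) s u
        (a := ⟨_, CircleMatching.leftNeighbour_mem (ρ s u).2 u⟩)
        ((hmin s u).trans_le (CircleMatching.userValue_le h s u _)))
  exact ⟨hnb, fun s => CircleMatching.le_two_mul_ncard_isGreedyAt fun u hu =>
    CircleMatching.isGreedyAt_reflection (hmin s) (hnb s) hu⟩
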